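/- Consider $N$ products and $K$ display positions. A feasible decision is a pair $(S,\sigma)$ with $S\subseteq[N]$, $|S|\le K$, and $\sigma:S\to[K]$ injective. An instance of the general position-effects model consists of known revenues $r_i\in[0,1]$ ($i\in[N]$) and unknown attractions $v_{i,k}\in(0,1]$ ($i\in[N]$, $k\in[K]$). When $(S,\sigma)$ is displayed, the customer buys $i\in S$ with probability $$\mathbb P(i\mid S,\sigma)=\frac{v_{i,\sigma(i)}}{1+\sum_{j\in S}v_{j,\sigma(j)}}$$ and buys nothing (outcome $0$) with the remaining probability $1/\bigl(1+\sum_{j\in S}v_{j,\sigma(j)}\bigr)$. The expected revenue is $R(S,\sigma)=\sum_{i\in S}r_i\,\mathbb P(i\mid S,\sigma)$. An admissible policy $\pi$ chooses in each round $t=1,\dots,T$ a feasible decision $(S_t,\sigma_t)$, possibly at random, on the basis of the revenues and of the past observations $(S_s,\sigma_s,i_s)_{s<t}$, where $i_s\in S_s\cup\{0\}$ is the customer's choice in round $s$; given the past and $(S_t,\sigma_t)$, the choice $i_t$ is drawn from $\mathbb P(\cdot\mid S_t,\sigma_t)$. Its regret is $$\mathrm{Regret}(T,\pi)=\mathbb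 E_\pi\Bigl[\sum_{t=1}^{T}\Bigl(\max_{(S,\sigma)}R(S,\sigma)-R(S_t,\sigma_t)\Bigr)\Bigr],$$ the maximum being over all feasible decisions. **Theorem.** There is an absolute constant $\eta\ge 10^{-3}$, namely $\eta=\frac{4}{675\sqrt3}$, such that for all $N,K,T$ with $K\le N/4$ and $T\ge\frac{4}{243}KN$ and for every admissible policy $\pi$, there is an instance of the general position-effects model on which $$\mathrm{Regret}(T,\pi)\ \ge\ \eta\sqrt{KNT}.$$ -/

import Mathlib

namespace PositionMNL

/-- A feasible decision `(S, σ)`: an assortment `S` of products together with an injective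
placement `σ : S → [K]`. Injectivity forces `|S| ≤ K`, see `Decision.card_le`. -/
abbrev Decision (N K : ℕ) : Type := Σ S : Finset (Fin N), (S ↪ Fin K)

theorem Decision.card_le {N K : ℕ} (d : Decision N K) : d.1.card ≤ K := by
  simpa using Fintype.card_le_of_embedding d.2

instance (N K : ℕ) : Nonempty (Decision N K) :=
  ⟨⟨∅, ⟨fun i => absurd i.2 (Finset.notMem_empty _), fun i => absurd i.2 (Finset.notMem_empty _)⟩⟩⟩

/-- An instance of the general position effects model: a revenue `r i ∈ [0, 1]` for every product
and an attraction `v i k ∈ (0, 1]` for every product-position pair. -/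
structure Instance (N K : ℕ) where
  r : Fin N → ℝ
  r_nonneg : ∀ i, 0 ≤ r i
  r_le_one : ∀ i, r i ≤ 1
  v : Fin N → Fin K → ℝ
  v_pos : ∀ i k, 0 < v i k
  v_le_one : ∀ i k, v i k ≤ 1

/-- The outcome of a round: `some i` is the purchase of product `i`, and `none` is the outside
option. -/
abbrev Outcome (N : ℕ) : Type := Option (Fin N)

namespace Instance

variable {N K : ℕ} (I : Instance N K)

/-- The total weight `1 + ∑_{j ∈ S} v_{j, σ(j)}`. -/
noncomputable def denom (d : Decision N K) : ℝ := 1 + ∑ j : d.1, I.v j (d.2 j)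

/-- The multinomial logit choice probabilities `ℙ(i | S, σ)`; a product that is not displayed is
never bought. -/
noncomputable def choiceProb (d : Decision N K) : Outcome N → ℝ
  | none => 1 / I.denom d
  | some i => if h : i ∈ d.1 then I.v i (d.2 ⟨i, h⟩) / I.denom d else 0

theorem denom_pos (d : Decision N K) : 0 < I.denom d := by
  have : 0 ≤ ∑ j : d.1, I.v j (d.2 j) := Finset.sum_nonneg fun j _ => (I.v_pos _ _).le
  unfold denom
  linarith

theorem choiceProb_nonneg (d : Decision N K) (o : Outcome N) : 0 ≤ I.choiceProb d o := by
  have hd := (I.denom_pos d).le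
  cases o with
  | none => exact div_nonneg zero_le_one hd
  | some i =>
    simp only [choiceProb]
    split_ifs with h
    · exact div_nonneg (I.v_pos _ _).le hd
    · exact le_rfl

theorem sum_choiceProb (d : Decision N K) : ∑ o, I.choiceProb d o = 1 := by
  have h1 : ∑ i : Fin N, I.choiceProb d (some i) = ∑ j : d.1, I.v j (d.2 j) / I.denom d := by
    rw [← Finset.sum_subset (Finset.subset_univ d.1), ← Finset.sum_coe_sort d.1]
    · refine Finset.sum_congr rfl fun j _ => ?_
      simp [choiceProb]
    · intro i _ hi
      simp [choiceProb, hi]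
  rw [Fintype.sum_option, h1, ← Finset.sum_div]
  change 1 / I.denom d + _ = 1
  rw [← add_div]
  exact div_self (I.denom_pos d).ne'

/-- The law of the customer's choice when the decision `d` is displayed. -/
noncomputable def choiceLaw (d : Decision N K) : PMF (Outcome N) :=
  PMF.ofFintype (fun o => ENNReal.ofReal (I.choiceProb d o)) (by
    rw [← ENNReal.ofReal_sum_of_nonneg fun o _ => I.choiceProb_nonneg d o, I.sum_choiceProb d,
      ENNReal.ofReal_one])

/-- The expected revenue `R(S, σ) = ∑_{i ∈ S} r_i ℙ(i | S, σ)`. -/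
noncomputable def revenue (d : Decision N K) : ℝ :=
  ∑ i ∈ d.1, I.r i * I.choiceProb d (some i)

/-- The maximal expected revenue over all feasible decisions. -/
noncomputable def optRevenue : ℝ :=
  (Finset.univ : Finset (Decision N K)).sup' Finset.univ_nonempty I.revenue

end Instance

/-- The observations `(S_s, σ_s, i_s)` of the first `t` rounds. -/
abbrev History (N K t : ℕ) : Type := Fin t → Decision N K × Outcome N

/-- An admissible (possibly randomized) policy: given the past observations of the first `t` rounds,
it draws the feasible decision of the next round. The revenues are known to the platform, so the
rule may also depend on them; it does not see the attractions. -/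
structure Policy (N K : ℕ) where
  rule : (Fin N → ℝ) → (t : ℕ) → History N K t → PMF (Decision N K)

/-- The law of the observations of the first `t` rounds when policy `π` is run on instance `I`. -/
noncomputable def historyLaw {N K : ℕ} (π : Policy N K) (I : Instance N K) :
    (t : ℕ) → PMF (History N K t)
  | 0 => PMF.pure Fin.elim0
  | t + 1 => (historyLaw π I t).bind fun h =>
      (π.rule I.r t h).bind fun d =>
        (I.choiceLaw d).map fun o => Fin.snoc (α := fun _ => Decision N K × Outcome N) h (d, o)

/-- The expected cumulative regret of `π` on the instance `I` over the horizon `T`. -/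
noncomputable def regret {N K : ℕ} (π : Policy N K) (I : Instance N K) (T : ℕ) : ℝ :=
  ∑ h : History N K T,
    (historyLaw π I T h).toReal * ∑ t : Fin T, (I.optRevenue - I.revenue (h t).1)

end PositionMNL

/-!
In the hard instances all revenues are `1` and every position `k` has one attractive product `e
k`, where `e : Fin K ↪ Fin N`; its attraction at `k` is `hi`, and all other attractions are `lo`.
A round costs a constant times `hi - lo` for every position that does not show its attractive
product.

Fix a position `k` and the attractive products of the other positions, and let `e k` run through
the `M = N - K + 1` remaining products. In the instance where `k` has no attractive product, the
expected display counts at `k` of the `M` candidates sum to at most `T`, so a typical candidate is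
displayed there only about `T / M` times. By the chain rule, the relative entropy between the
histories with and without the attractive product `e k` is at most `(hi - lo) ^ 2 / hi` times the
expected display count of `e k`, so a Pinsker-type inequality shows that the policy displays `e k`
at `k` hardly more often when it is attractive. Averaging over all embeddings gives one `e` for
which, on average over the positions, the attractive product is missing in a constant fraction of
the rounds. Taking `hi` of order `1 / K` and `hi - lo` of order `√(N / (K * T))` yields the bound.
-/

namespace PositionMNL

section FiniteExpectation

theorem toReal_ne_zero_iff {α : Type*} {p : PMF α} {a : α} : (p a).toReal ≠ 0 ↔ a ∈ p.support := by
  simp [ENNReal.toReal_ne_zero, p.apply_ne_top, PMF.mem_support_iff]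

variable {α β : Type*} [Fintype α] [Fintype β]

theorem sum_toReal_eq_one (p : PMF α) : ∑ a, (p a).toReal = 1 := by
  rw [← ENNReal.toReal_sum fun a _ => p.apply_ne_top a, ← tsum_fintype (L := .unconditional α),
    p.tsum_coe, ENNReal.toReal_one]

/-- The expectation of a real function under a probability mass function on a finite type, written
as a finite sum so that no measurable structure is needed. -/
noncomputable def expectation (p : PMF α) (f : α → ℝ) : ℝ := ∑ a, (p a).toReal * f a

theorem expectation_const (p : PMF α) (c : ℝ) : expectation p (fun _ => c) = c := by
  rw [expectation, ← Finset.sum_mul, sum_toReal_eq_one, one_mul]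

theorem expectation_add (p : PMF α) (f g : α → ℝ) :
    expectation p (fun a => f a + g a) = expectation p f + expectation p g := by
  simp only [expectation, mul_add, Finset.sum_add_distrib]

theorem expectation_sub (p : PMF α) (f g : α → ℝ) :
    expectation p (fun a => f a - g a) = expectation p f - expectation p g := by
  simp only [expectation, mul_sub, Finset.sum_sub_distrib]

theorem expectation_const_mul (p : PMF α) (c : ℝ) (f : α → ℝ) :
    expectation p (fun a => c * f a) = c * expectation p f := by
  simp only [expectation, Finset.mul_sum, mul_left_comm]

theorem expectation_sum {ι : Type*} (p : PMF α) (s : Finset ι) (f : ι → α → ℝ) :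
    expectation p (fun a => ∑ i ∈ s, f i a) = ∑ i ∈ s, expectation p (f i) := by
  simp only [expectation, Finset.mul_sum]
  exact Finset.sum_comm

theorem expectation_mono (p : PMF α) {f g : α → ℝ} (h : ∀ a, f a ≤ g a) :
    expectation p f ≤ expectation p g :=
  Finset.sum_le_sum fun a _ => mul_le_mul_of_nonneg_left (h a) ENNReal.toReal_nonneg

theorem expectation_nonneg (p : PMF α) {f : α → ℝ} (h : ∀ a, 0 ≤ f a) : 0 ≤ expectation p f :=
  Finset.sum_nonneg fun a _ => mul_nonneg ENNReal.toReal_nonneg (h a)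

theorem expectation_congr_support (p : PMF α) {f g : α → ℝ} (h : ∀ a ∈ p.support, f a = g a) :
    expectation p f = expectation p g := by
  refine Finset.sum_congr rfl fun a _ => ?_
  by_cases ha : p a = 0
  · simp only [ha, ENNReal.toReal_zero, zero_mul]
  · rw [h a ((p.mem_support_iff a).2 ha)]

theorem expectation_pure (a : α) (f : α → ℝ) : expectation (PMF.pure a) f = f a := by
  classical
  simp [expectation, PMF.pure_apply, apply_ite ENNReal.toReal]

theorem expectation_bind (p : PMF α) (κ : α → PMF β) (f : β → ℝ) :
    expectation (p.bind κ) f = expectation p fun a => expectation (κ a) f := by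
  have bind_toReal (b : β) : (p.bind κ b).toReal = ∑ a, (p a).toReal * (κ a b).toReal := by
    rw [PMF.bind_apply, tsum_fintype, ENNReal.toReal_sum fun a _ =>
      ENNReal.mul_ne_top (p.apply_ne_top a) ((κ a).apply_ne_top b)]
    simp only [ENNReal.toReal_mul]
  simp only [expectation, bind_toReal, Finset.sum_mul, Finset.mul_sum, mul_assoc]
  exact Finset.sum_comm

theorem expectation_map (p : PMF α) (g : α → β) (f : β → ℝ) :
    expectation (p.map g) f = expectation p fun a => f (g a) := by
  rw [← PMF.bind_pure_comp, expectation_bind]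
  simp only [Function.comp_apply, expectation_pure]

end FiniteExpectation

section CompProd

variable {α β : Type*}

/-- The joint law of a sample `a` of `p` and a subsequent sample of `κ a`: the analogue for
probability mass functions of the composition-product of a measure and a kernel. -/
noncomputable def compProd (p : PMF α) (κ : α → PMF β) : PMF (α × β) :=
  p.bind fun a => (κ a).map (Prod.mk a)

theorem map_apply_of_injective {f : α → β} (hf : Function.Injective f) (p : PMF α) (a : α) :
    p.map f (f a) = p a := by
  classical
  simp only [PMF.map_apply, hf.eq_iff, tsum_ite_eq']

theorem compProd_apply (p : PMF α) (κ : α → PMF β) (a : α) (b : β) :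
    compProd p κ (a, b) = p a * κ a b := by
  rw [compProd, PMF.bind_apply, tsum_eq_single a,
    map_apply_of_injective (Prod.mk_right_injective a)]
  intro a' ha
  have : (κ a').map (Prod.mk a') (a, b) = 0 := (PMF.apply_eq_zero_iff _ _).2 (by simp [ha])
  rw [this, mul_zero]

theorem expectation_compProd [Fintype α] [Fintype β] (p : PMF α) (κ : α → PMF β)
    (f : α × β → ℝ) :
    expectation (compProd p κ) f = expectation p fun a => expectation (κ a) fun b => f (a, b) := by
  simp only [compProd, expectation_bind, expectation_map]

theorem support_compProd_subset {p q : PMF α} {κ l : α → PMF β} (hpq : p.support ⊆ q.support)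
    (hκ : ∀ a, (κ a).support ⊆ (l a).support) :
    (compProd p κ).support ⊆ (compProd q l).support := by
  rintro ⟨a, b⟩ hab
  rw [PMF.mem_support_iff, compProd_apply, mul_ne_zero_iff] at hab ⊢
  exact ⟨hpq hab.1, hκ a hab.2⟩

end CompProd

section RelativeEntropy

variable {α β : Type*} [Fintype α] [Fintype β]

/-- The relative entropy (Kullback–Leibler divergence) of `p` with respect to `q`. It is real
valued, and has its usual meaning only if `p.support ⊆ q.support`: outside the support of `q` the
quotient takes the junk value `0`, where the true divergence is infinite. -/
noncomputable def relEntropy (p q : PMF α) : ℝ :=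
  expectation p fun a => Real.log ((p a).toReal / (q a).toReal)

theorem relEntropy_self (p : PMF α) : relEntropy p p = 0 := by
  rw [relEntropy, expectation_congr_support p (g := fun _ => 0), expectation_const]
  intro a ha
  rw [div_self (toReal_ne_zero_iff.2 ha), Real.log_one]

theorem relEntropy_map {f : α → β} (hf : Function.Injective f) (p q : PMF α) :
    relEntropy (p.map f) (q.map f) = relEntropy p q := by
  simp only [relEntropy, expectation_map, map_apply_of_injective hf]

theorem relEntropy_compProd {p q : PMF α} {κ l : α → PMF β} (hpq : p.support ⊆ q.support)
    (hκ : ∀ a, (κ a).support ⊆ (l a).support) :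
    relEntropy (compProd p κ) (compProd q l) =
      relEntropy p q + expectation p fun a => relEntropy (κ a) (l a) := by
  have log_split (a : α) (ha : a ∈ p.support) :
      (expectation (κ a) fun b =>
        Real.log ((compProd p κ (a, b)).toReal / (compProd q l (a, b)).toReal)) =
      Real.log ((p a).toReal / (q a).toReal) + relEntropy (κ a) (l a) := by
    rw [relEntropy, ← expectation_const (κ a) (Real.log ((p a).toReal / (q a).toReal)),
      ← expectation_add]
    refine expectation_congr_support _ fun b hb => ?_
    rw [compProd_apply, compProd_apply, ENNReal.toReal_mul, ENNReal.toReal_mul,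
      mul_div_mul_comm,
      Real.log_mul (div_ne_zero (toReal_ne_zero_iff.2 ha) (toReal_ne_zero_iff.2 (hpq ha)))
        (div_ne_zero (toReal_ne_zero_iff.2 hb) (toReal_ne_zero_iff.2 (hκ a hb)))]
  rw [relEntropy, expectation_compProd, expectation_congr_support p log_split, expectation_add,
    ← relEntropy]

theorem sq_sqrt_sub_sqrt_le {x y : ℝ} (hx : 0 ≤ x) (hy : 0 ≤ y) (hxy : y = 0 → x = 0) :
    (√x - √y) ^ 2 ≤ x * Real.log (x / y) - x + y := by
  rcases hx.eq_or_lt with rfl | hx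
  · simp [Real.sq_sqrt hy]
  have hy : 0 < y := hy.lt_of_ne fun h => hx.ne' (hxy h.symm)
  have hlog : Real.log (x / y) = -2 * Real.log (√y / √x) := by
    rw [← Real.sqrt_div' _ hx.le, Real.log_sqrt (by positivity), ← inv_div y x, Real.log_inv]
    ring
  have hbound : x * Real.log (√y / √x) ≤ √x * √y - x :=
    calc x * Real.log (√y / √x) ≤ x * (√y / √x - 1) := by
          gcongr
          exact Real.log_le_sub_one_of_pos (by positivity)
      _ = √x * √y - x := by
          rw [mul_sub, mul_one, mul_div_left_comm, Real.div_sqrt, mul_comm]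
  rw [hlog, sub_sq, Real.sq_sqrt hx.le, Real.sq_sqrt hy.le]
  linarith

theorem sum_sq_sqrt_sub_sqrt_le_relEntropy {p q : PMF α} (hpq : p.support ⊆ q.support) :
    ∑ a, (√(p a).toReal - √(q a).toReal) ^ 2 ≤ relEntropy p q := by
  have hzero (a : α) (hq : (q a).toReal = 0) : (p a).toReal = 0 := by
    by_contra hp
    exact toReal_ne_zero_iff.2 (hpq (toReal_ne_zero_iff.1 hp)) hq
  refine (Finset.sum_le_sum fun a _ => sq_sqrt_sub_sqrt_le ENNReal.toReal_nonneg
    ENNReal.toReal_nonneg (hzero a)).trans_eq ?_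
  rw [Finset.sum_add_distrib, Finset.sum_sub_distrib, sum_toReal_eq_one, sum_toReal_eq_one,
    sub_add_cancel, relEntropy, expectation]

/- This is Pinsker's inequality up to a factor `√2`, which is lost by passing through the Hellinger
distance. -/
theorem sum_abs_sub_le_two_mul_sqrt_relEntropy {p q : PMF α} (hpq : p.support ⊆ q.support) :
    ∑ a, |(p a).toReal - (q a).toReal| ≤ 2 * √(relEntropy p q) := by
  have factor (a : α) : |(p a).toReal - (q a).toReal| =
      |√(p a).toReal - √(q a).toReal| * (√(p a).toReal + √(q a).toReal) := by
    rw [← abs_of_nonneg (add_nonneg (Real.sqrt_nonneg (p a).toReal) (Real.sqrt_nonneg _)),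
      ← abs_mul, mul_comm, ← sq_sub_sq, Real.sq_sqrt ENNReal.toReal_nonneg,
      Real.sq_sqrt ENNReal.toReal_nonneg]
  have sum_sq_add : ∑ a, (√(p a).toReal + √(q a).toReal) ^ 2 ≤ 2 ^ 2 :=
    calc ∑ a, (√(p a).toReal + √(q a).toReal) ^ 2
        ≤ ∑ a, 2 * ((p a).toReal + (q a).toReal) := Finset.sum_le_sum fun a _ => by
          refine add_sq_le.trans_eq ?_
          rw [Real.sq_sqrt ENNReal.toReal_nonneg, Real.sq_sqrt ENNReal.toReal_nonneg]
      _ = 2 ^ 2 := by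
          rw [← Finset.mul_sum, Finset.sum_add_distrib, sum_toReal_eq_one, sum_toReal_eq_one]
          norm_num
  calc ∑ a, |(p a).toReal - (q a).toReal|
      = ∑ a, |√(p a).toReal - √(q a).toReal| * (√(p a).toReal + √(q a).toReal) :=
        Finset.sum_congr rfl fun a _ => factor a
    _ ≤ √(∑ a, |√(p a).toReal - √(q a).toReal| ^ 2) *
          √(∑ a, (√(p a).toReal + √(q a).toReal) ^ 2) := Real.sum_mul_le_sqrt_mul_sqrt _ _ _
    _ ≤ √(relEntropy p q) * 2 := by
        simp only [sq_abs]
        exact mul_le_mul (Real.sqrt_le_sqrt (sum_sq_sqrt_sub_sqrt_le_relEntropy hpq))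
          (Real.sqrt_le_iff.2 ⟨zero_le_two, sum_sq_add⟩) (Real.sqrt_nonneg _) (Real.sqrt_nonneg _)
    _ = 2 * √(relEntropy p q) := mul_comm _ _

theorem expectation_le_add_mul_sqrt_relEntropy {p q : PMF α} (hpq : p.support ⊆ q.support)
    {f : α → ℝ} {B : ℝ} (hf : ∀ a, f a ∈ Set.Icc 0 B) :
    expectation q f ≤ expectation p f + B * √(relEntropy p q) := by
  have hB : 0 ≤ B := by
    obtain ⟨a, _⟩ := p.support_nonempty
    exact (hf a).1.trans (hf a).2
  -- Centring `f` at `B / 2` halves its sup norm and does not change the difference of expectations.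
  have centre : expectation q f - expectation p f =
      ∑ a, ((q a).toReal - (p a).toReal) * (f a - B / 2) := by
    simp only [sub_mul, mul_sub, Finset.sum_sub_distrib, ← Finset.sum_mul, sum_toReal_eq_one,
      expectation]
    ring
  have bound : ∑ a, ((q a).toReal - (p a).toReal) * (f a - B / 2) ≤
      ∑ a, |(p a).toReal - (q a).toReal| * (B / 2) := Finset.sum_le_sum fun a _ => by
    refine (le_abs_self _).trans ?_
    rw [abs_mul, abs_sub_comm]
    gcongr
    exact abs_le.2 ⟨by linarith [(hf a).1], by linarith [(hf a).2]⟩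
  rw [← Finset.sum_mul] at bound
  have := mul_le_mul_of_nonneg_right (sum_abs_sub_le_two_mul_sqrt_relEntropy hpq)
    (div_nonneg hB zero_le_two)
  linarith

end RelativeEntropy

section Choice

namespace Instance

variable {N K : ℕ} (I J : Instance N K)

theorem one_le_denom (d : Decision N K) : 1 ≤ I.denom d :=
  le_add_of_nonneg_right (Finset.sum_nonneg fun _ _ => (I.v_pos _ _).le)

theorem choiceLaw_apply_toReal (d : Decision N K) (o : Outcome N) :
    (I.choiceLaw d o).toReal = I.choiceProb d o := by
  rw [choiceLaw, PMF.ofFintype_apply, ENNReal.toReal_ofReal (I.choiceProb_nonneg d o)]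

theorem choiceProb_some_coe (d : Decision N K) (j : d.1) :
    I.choiceProb d (some ↑j) = I.v j (d.2 j) / I.denom d := by
  simp only [choiceProb, j.2, dif_pos]

theorem support_choiceLaw (d : Decision N K) :
    (I.choiceLaw d).support = {o | ∀ i ∈ o, i ∈ d.1} := by
  ext o
  rw [← toReal_ne_zero_iff, choiceLaw_apply_toReal]
  cases o with
  | none => simp [choiceProb, (I.denom_pos d).ne']
  | some i =>
    by_cases hi : i ∈ d.1 <;> simp [choiceProb, hi, (I.v_pos _ _).ne', (I.denom_pos d).ne']

theorem expectation_choiceLaw (d : Decision N K) (f : Outcome N → ℝ) :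
    expectation (I.choiceLaw d) f =
      (f none + ∑ j : d.1, I.v j (d.2 j) * f (some ↑j)) / I.denom d := by
  have sum_some : ∑ i : Fin N, I.choiceProb d (some i) * f (some i) =
      ∑ j : d.1, I.v j (d.2 j) / I.denom d * f (some ↑j) := by
    rw [← Finset.sum_subset (Finset.subset_univ d.1), ← Finset.sum_coe_sort d.1]
    · exact Finset.sum_congr rfl fun j _ => by rw [choiceProb_some_coe]
    · intro i _ hi
      simp only [choiceProb, hi, dif_neg, not_false_eq_true, zero_mul]
  simp only [expectation, choiceLaw_apply_toReal, Fintype.sum_option]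
  rw [sum_some, choiceProb, add_div, Finset.sum_div, div_mul_eq_mul_div, one_mul]
  simp only [div_mul_eq_mul_div]

theorem relEntropy_choiceLaw (d : Decision N K) :
    relEntropy (I.choiceLaw d) (J.choiceLaw d) = Real.log (J.denom d / I.denom d) +
      (∑ j : d.1, I.v j (d.2 j) * Real.log (I.v j (d.2 j) / J.v j (d.2 j))) / I.denom d := by
  have hI := I.denom_pos d
  have hJ := J.denom_pos d
  have log_some (j : d.1) :
      Real.log ((I.choiceLaw d (some ↑j)).toReal / (J.choiceLaw d (some ↑j)).toReal) =
        Real.log (J.denom d / I.denom d) + Real.log (I.v j (d.2 j) / J.v j (d.2 j)) := by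
    have hv := I.v_pos j (d.2 j)
    have hw := J.v_pos j (d.2 j)
    rw [← Real.log_mul (by positivity) (by positivity), choiceLaw_apply_toReal,
      choiceLaw_apply_toReal, choiceProb_some_coe, choiceProb_some_coe]
    congr 1
    field_simp
  rw [relEntropy, expectation_choiceLaw]
  simp only [log_some, mul_add, Finset.sum_add_distrib, ← Finset.sum_mul]
  rw [choiceLaw_apply_toReal, choiceLaw_apply_toReal, choiceProb, choiceProb,
    div_div_div_cancel_left' _ _ one_ne_zero, ← add_assoc, ← one_add_mul, ← denom, add_div,
    mul_div_cancel_left₀ _ hI.ne']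

theorem relEntropy_choiceLaw_le (d : Decision N K) :
    relEntropy (I.choiceLaw d) (J.choiceLaw d) ≤
      ∑ j : d.1, (I.v j (d.2 j) - J.v j (d.2 j)) ^ 2 / J.v j (d.2 j) := by
  have hI := I.denom_pos d
  have log_denom : Real.log (J.denom d / I.denom d) ≤
      (∑ j : d.1, (J.v j (d.2 j) - I.v j (d.2 j))) / I.denom d := by
    refine (Real.log_le_sub_one_of_pos (div_pos (J.denom_pos d) hI)).trans_eq ?_
    rw [div_sub_one hI.ne', denom, denom, add_sub_add_left_eq_sub, Finset.sum_sub_distrib]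
  have mul_log_le (j : d.1) : I.v j (d.2 j) * Real.log (I.v j (d.2 j) / J.v j (d.2 j)) ≤
      I.v j (d.2 j) * (I.v j (d.2 j) / J.v j (d.2 j) - 1) :=
    mul_le_mul_of_nonneg_left (Real.log_le_sub_one_of_pos (div_pos (I.v_pos _ _) (J.v_pos _ _)))
      (I.v_pos _ _).le
  have chi_sq (j : d.1) : J.v j (d.2 j) - I.v j (d.2 j) +
      I.v j (d.2 j) * (I.v j (d.2 j) / J.v j (d.2 j) - 1) =
      (I.v j (d.2 j) - J.v j (d.2 j)) ^ 2 / J.v j (d.2 j) := by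
    have := (J.v_pos j (d.2 j)).ne'
    field_simp
    ring
  calc relEntropy (I.choiceLaw d) (J.choiceLaw d)
      ≤ (∑ j : d.1, (J.v j (d.2 j) - I.v j (d.2 j))) / I.denom d +
          (∑ j : d.1, I.v j (d.2 j) * (I.v j (d.2 j) / J.v j (d.2 j) - 1)) / I.denom d := by
        rw [relEntropy_choiceLaw]
        exact add_le_add log_denom
          (div_le_div_of_nonneg_right (Finset.sum_le_sum fun j _ => mul_log_le j) hI.le)
    _ = (∑ j : d.1, (I.v j (d.2 j) - J.v j (d.2 j)) ^ 2 / J.v j (d.2 j)) / I.denom d := by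
        rw [← add_div, ← Finset.sum_add_distrib]
        simp only [chi_sq]
    _ ≤ ∑ j : d.1, (I.v j (d.2 j) - J.v j (d.2 j)) ^ 2 / J.v j (d.2 j) :=
        div_le_self (Finset.sum_nonneg fun j _ => div_nonneg (sq_nonneg _) (J.v_pos _ _).le)
          (I.one_le_denom d)

theorem revenue_eq_one_sub (hr : ∀ i, I.r i = 1) (d : Decision N K) :
    I.revenue d = 1 - 1 / I.denom d := by
  have hI := (I.denom_pos d).ne'
  rw [revenue, ← Finset.sum_coe_sort d.1]
  simp only [hr, one_mul, choiceProb_some_coe]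
  rw [← Finset.sum_div, one_sub_div hI, denom, add_sub_cancel_left]

theorem revenue_le_optRevenue (d : Decision N K) : I.revenue d ≤ I.optRevenue :=
  Finset.le_sup' I.revenue (Finset.mem_univ d)

end Instance

end Choice

section History

variable {N K : ℕ}

theorem historyLaw_succ (π : Policy N K) (I : Instance N K) (t : ℕ) :
    historyLaw π I (t + 1) =
      (compProd (historyLaw π I t) fun h => compProd (π.rule I.r t h) I.choiceLaw).map
        fun x => Fin.snoc (α := fun _ => Decision N K × Outcome N) x.1 x.2 := by
  simp only [historyLaw, compProd, PMF.map_bind, PMF.map_comp, Function.comp_def]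

theorem snoc_uncurry_injective {α : Type*} (t : ℕ) :
    Function.Injective fun x : (Fin t → α) × α => Fin.snoc (α := fun _ => α) x.1 x.2 :=
  fun _ _ hxy => Prod.ext_iff.2 (Fin.snoc_inj.1 hxy)

theorem support_historyLaw_subset (π : Policy N K) {I J : Instance N K} (hr : I.r = J.r) (T : ℕ) :
    (historyLaw π I T).support ⊆ (historyLaw π J T).support := by
  induction T with
  | zero => exact subset_rfl
  | succ t ih =>
    rw [historyLaw_succ, historyLaw_succ, hr, PMF.support_map, PMF.support_map]
    refine Set.image_mono (support_compProd_subset ih fun h => ?_)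
    refine support_compProd_subset subset_rfl fun d => ?_
    rw [I.support_choiceLaw, J.support_choiceLaw]

/- The chain rule for relative entropy: the decisions contribute nothing, because the policy draws
them in the same way under both instances. -/
theorem relEntropy_historyLaw (π : Policy N K) {I J : Instance N K} (hr : I.r = J.r) (T : ℕ) :
    relEntropy (historyLaw π I T) (historyLaw π J T) = expectation (historyLaw π I T) fun h =>
      ∑ t, relEntropy (I.choiceLaw (h t).1) (J.choiceLaw (h t).1) := by
  have support_choiceLaw_subset (d : Decision N K) :
      (I.choiceLaw d).support ⊆ (J.choiceLaw d).support := by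
    rw [I.support_choiceLaw, J.support_choiceLaw]
  induction T with
  | zero => simp only [historyLaw, relEntropy_self, expectation_pure, Finset.univ_eq_empty,
      Finset.sum_empty]
  | succ t ih =>
    have round_entropy (h : History N K t) :
        relEntropy (compProd (π.rule I.r t h) I.choiceLaw)
          (compProd (π.rule J.r t h) J.choiceLaw) =
        expectation (π.rule I.r t h) fun d => relEntropy (I.choiceLaw d) (J.choiceLaw d) := by
      rw [hr, relEntropy_compProd subset_rfl support_choiceLaw_subset, relEntropy_self, zero_add]
    rw [historyLaw_succ, historyLaw_succ, relEntropy_map (snoc_uncurry_injective t),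
      relEntropy_compProd (support_historyLaw_subset π hr t) fun h => hr ▸
        support_compProd_subset subset_rfl support_choiceLaw_subset, ih]
    simp only [round_entropy, expectation_map, expectation_compProd, Fin.sum_univ_castSucc,
      Fin.snoc_castSucc, Fin.snoc_last, expectation_add, expectation_const]

theorem regret_eq_expectation (π : Policy N K) (I : Instance N K) (T : ℕ) :
    regret π I T = expectation (historyLaw π I T) fun h =>
      ∑ t, (I.optRevenue - I.revenue (h t).1) := rfl

theorem regret_nonneg (π : Policy N K) (I : Instance N K) (T : ℕ) : 0 ≤ regret π I T :=
  expectation_nonneg _ fun _ => Finset.sum_nonneg fun _ _ =>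
    sub_nonneg.2 (I.revenue_le_optRevenue _)

end History

section DisplayCount

variable {N K : ℕ}

/-- The decision `d` shows product `i` at position `k`. -/
def Decision.Displays (d : Decision N K) (i : Fin N) (k : Fin K) : Prop :=
  ∃ hi : i ∈ d.1, d.2 ⟨i, hi⟩ = k

instance (d : Decision N K) (i : Fin N) (k : Fin K) : Decidable (d.Displays i k) :=
  inferInstanceAs (Decidable (∃ _, _))

theorem Decision.sum_ite_displays_eq (d : Decision N K) (i : Fin N) (k : Fin K) (c : ℝ) :
    ∑ j : d.1, (if ((j : Fin N), d.2 j) = (i, k) then c else 0) =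
      if d.Displays i k then c else 0 := by
  split_ifs with h
  · obtain ⟨hi, rfl⟩ := h
    rw [Fintype.sum_eq_single ⟨i, hi⟩, if_pos rfl]
    exact fun j hj => if_neg fun h => hj (Subtype.ext (Prod.ext_iff.1 h).1)
  · refine Finset.sum_eq_zero fun j _ => if_neg fun hj => h ?_
    obtain ⟨rfl, rfl⟩ := Prod.ext_iff.1 hj
    exact ⟨j.2, rfl⟩

theorem Decision.sum_ite_displays_le_one (d : Decision N K) (k : Fin K) :
    ∑ i, (if d.Displays i k then 1 else 0 : ℝ) ≤ 1 := by
  rw [Finset.sum_boole]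
  refine Nat.cast_le_one.2 (Finset.card_le_one.2 fun i hi j hj => ?_)
  obtain ⟨hi, hik⟩ := (Finset.mem_filter.1 hi).2
  obtain ⟨hj, hjk⟩ := (Finset.mem_filter.1 hj).2
  exact Subtype.ext_iff.1 (d.2.injective (hik.trans hjk.symm))

/-- The expected number of the first `T` rounds in which `π`, run on the instance `I`, displays
product `i` at position `k`. -/
noncomputable def expDisplayCount (π : Policy N K) (I : Instance N K) (T : ℕ) (i : Fin N)
    (k : Fin K) : ℝ :=
  expectation (historyLaw π I T) fun h => ∑ t, if (h t).1.Displays i k then 1 else 0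

theorem expDisplayCount_nonneg (π : Policy N K) (I : Instance N K) (T : ℕ) (i : Fin N)
    (k : Fin K) : 0 ≤ expDisplayCount π I T i k :=
  expectation_nonneg _ fun _ => Finset.sum_nonneg fun _ _ => by positivity

theorem sum_expDisplayCount_le (π : Policy N K) (I : Instance N K) (T : ℕ) (k : Fin K)
    (s : Finset (Fin N)) : ∑ i ∈ s, expDisplayCount π I T i k ≤ T := by
  have sum_le (h : History N K T) : ∑ i, ∑ t, (if (h t).1.Displays i k then 1 else 0 : ℝ) ≤ T := by
    rw [Finset.sum_comm]
    refine (Finset.sum_le_sum fun t _ => (h t).1.sum_ite_displays_le_one k).trans_eq ?_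
    rw [Finset.sum_const, Finset.card_univ, Fintype.card_fin, nsmul_one]
  calc ∑ i ∈ s, expDisplayCount π I T i k
      ≤ ∑ i, expDisplayCount π I T i k :=
        Finset.sum_le_univ_sum_of_nonneg fun i => expDisplayCount_nonneg π I T i k
    _ ≤ T := by
        unfold expDisplayCount
        rw [← expectation_sum]
        exact (expectation_mono _ sum_le).trans_eq (expectation_const _ _)

end DisplayCount

section Planted

variable {N K : ℕ} (lo hi : Set.Ioc (0 : ℝ) 1)

open Classical in
/-- The instance with unit revenues in which the pairs in `A` have attraction `hi` and all other
pairs have attraction `lo`. -/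
noncomputable def planted (A : Set (Fin N × Fin K)) : Instance N K where
  r _ := 1
  r_nonneg _ := zero_le_one
  r_le_one _ := le_rfl
  v i k := if (i, k) ∈ A then hi else lo
  v_pos i k := by split_ifs; exacts [hi.2.1, lo.2.1]
  v_le_one i k := by split_ifs; exacts [hi.2.2, lo.2.2]

variable {A : Set (Fin N × Fin K)} {i : Fin N} {k : Fin K}

theorem planted_v_of_mem (h : (i, k) ∈ A) : (planted lo hi A).v i k = hi := if_pos h

theorem planted_v_of_notMem (h : (i, k) ∉ A) : (planted lo hi A).v i k = lo := if_neg h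

variable (A i k)

theorem relEntropy_choiceLaw_planted_insert_le (d : Decision N K) :
    relEntropy ((planted lo hi A).choiceLaw d) ((planted lo hi (insert (i, k) A)).choiceLaw d) ≤
      ((hi : ℝ) - lo) ^ 2 / hi * if d.Displays i k then 1 else 0 := by
  have hhi : (0 : ℝ) < hi := hi.2.1
  rw [mul_ite, mul_one, mul_zero, ← d.sum_ite_displays_eq]
  refine (Instance.relEntropy_choiceLaw_le _ _ d).trans (Finset.sum_le_sum fun j _ => ?_)
  split_ifs with hj
  · obtain ⟨rfl, rfl⟩ := Prod.ext_iff.1 hj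
    rw [planted_v_of_mem lo hi (Set.mem_insert _ A)]
    by_cases hA : ((j : Fin N), d.2 j) ∈ A
    · rw [planted_v_of_mem lo hi hA, sub_self, zero_pow two_ne_zero, zero_div]
      positivity
    · rw [planted_v_of_notMem lo hi hA, sub_sq_comm]
  · have unchanged :
        (planted lo hi (insert (i, k) A)).v j (d.2 j) = (planted lo hi A).v j (d.2 j) := by
      by_cases hA : ((j : Fin N), d.2 j) ∈ A
      · rw [planted_v_of_mem lo hi hA, planted_v_of_mem lo hi (Set.mem_insert_of_mem _ hA)]
      · rw [planted_v_of_notMem lo hi hA,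
          planted_v_of_notMem lo hi fun h => hA (h.resolve_left hj)]
    rw [unchanged, sub_self, zero_pow two_ne_zero, zero_div]

/- The two instances differ only in the attraction of `(i, k)`, so only the rounds in which that
pair is displayed carry information on which of them is the true one. -/
theorem expDisplayCount_planted_insert_le (π : Policy N K) (T : ℕ) :
    expDisplayCount π (planted lo hi (insert (i, k) A)) T i k ≤
      expDisplayCount π (planted lo hi A) T i k +
        T * √(((hi : ℝ) - lo) ^ 2 / hi * expDisplayCount π (planted lo hi A) T i k) := by
  have count_mem (h : History N K T) :
      ∑ t, (if (h t).1.Displays i k then 1 else 0 : ℝ) ∈ Set.Icc (0 : ℝ) T := by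
    refine ⟨Finset.sum_nonneg fun _ _ => by positivity, ?_⟩
    rw [Finset.sum_boole]
    exact_mod_cast (Finset.card_le_univ _).trans_eq (Fintype.card_fin T)
  have hr : (planted lo hi A).r = (planted lo hi (insert (i, k) A)).r := rfl
  have relEntropy_le : relEntropy (historyLaw π (planted lo hi A) T)
      (historyLaw π (planted lo hi (insert (i, k) A)) T) ≤
      ((hi : ℝ) - lo) ^ 2 / hi * expDisplayCount π (planted lo hi A) T i k := by
    rw [relEntropy_historyLaw π hr, expDisplayCount, ← expectation_const_mul]
    refine expectation_mono _ fun h => ?_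
    rw [Finset.mul_sum]
    exact Finset.sum_le_sum fun t _ => relEntropy_choiceLaw_planted_insert_le lo hi A i k (h t).1
  refine (expectation_le_add_mul_sqrt_relEntropy (support_historyLaw_subset π hr T)
    count_mem).trans ?_
  rw [← expDisplayCount]
  gcongr

theorem sum_expDisplayCount_planted_insert_le (π : Policy N K) (T : ℕ) {s : Finset (Fin N)}
    (hs : s.Nonempty) :
    ∑ i ∈ s, expDisplayCount π (planted lo hi (insert (i, k) A)) T i k ≤
      s.card * (T * (1 / s.card + √(((hi : ℝ) - lo) ^ 2 / hi * T / s.card))) := by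
  set c : ℝ := ((hi : ℝ) - lo) ^ 2 / hi
  set X : Fin N → ℝ := (expDisplayCount π (planted lo hi A) T · k)
  have hc : 0 ≤ c := div_nonneg (sq_nonneg _) hi.2.1.le
  have hcard : (0 : ℝ) < s.card := Nat.cast_pos.2 hs.card_pos
  have sum_X : ∑ i ∈ s, X i ≤ T := sum_expDisplayCount_le π _ T k s
  have sum_sqrt : ∑ i ∈ s, √(c * X i) ≤ s.card * √(c * T / s.card) :=
    calc ∑ i ∈ s, √(c * X i)
        = ∑ i ∈ s, √1 * √(c * X i) := by simp only [Real.sqrt_one, one_mul]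
      _ ≤ √(∑ _i ∈ s, 1) * √(∑ i ∈ s, c * X i) :=
        Real.sum_sqrt_mul_sqrt_le _ (fun _ => zero_le_one)
          fun i => mul_nonneg hc (expDisplayCount_nonneg π _ T i k)
      _ ≤ √s.card * √(c * T) := by
          rw [← Finset.mul_sum, Finset.sum_const, nsmul_one]
          gcongr
      _ = s.card * √(c * T / s.card) := by
          rw [Real.sqrt_div (by positivity), mul_div_left_comm, Real.div_sqrt, mul_comm]
  calc ∑ i ∈ s, expDisplayCount π (planted lo hi (insert (i, k) A)) T i k
      ≤ ∑ i ∈ s, (X i + T * √(c * X i)) :=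
        Finset.sum_le_sum fun i _ => expDisplayCount_planted_insert_le lo hi A i k π T
    _ ≤ T + T * (s.card * √(c * T / s.card)) := by
        rw [Finset.sum_add_distrib, ← Finset.mul_sum]
        gcongr
    _ = s.card * (T * (1 / s.card + √(c * T / s.card))) := by
        field_simp

end Planted

section Embedding

variable {α β : Type*} [Fintype α] [Fintype β] [DecidableEq α] [DecidableEq β]

theorem sum_embedding_eq_sum_compl (k : α) (G : ({a // a ≠ k} ↪ β) → β → ℝ) :
    ∑ e : α ↪ β, G ((Function.Embedding.subtype _).trans e) (e k) =
      ∑ f, ∑ i ∈ (Finset.univ.map f)ᶜ, G f i := by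
  have sum_compl (f : {a // a ≠ k} ↪ β) :
      ∑ i ∈ (Finset.univ.map f)ᶜ, G f i = ∑ i : ↥(Set.range f)ᶜ, G f i :=
    Finset.sum_subtype _ (by simp) _
  simp only [sum_compl, ← Fintype.sum_sigma']
  exact Fintype.sum_equiv ((Equiv.embeddingCongr (Equiv.optionSubtypeNe k).symm
    (Equiv.refl β)).trans (Function.Embedding.optionEmbeddingEquiv _ _)) _ _ fun _ => rfl

theorem sum_embedding_le_card_mul (k : α) (G : ({a // a ≠ k} ↪ β) → β → ℝ) {B : ℝ}
    (hG : ∀ f : {a // a ≠ k} ↪ β,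
      ∑ i ∈ (Finset.univ.map f)ᶜ, G f i ≤ (Finset.univ.map f)ᶜ.card * B) :
    ∑ e : α ↪ β, G ((Function.Embedding.subtype _).trans e) (e k) ≤
      Fintype.card (α ↪ β) * B :=
  calc ∑ e : α ↪ β, G ((Function.Embedding.subtype _).trans e) (e k)
      ≤ ∑ f : {a // a ≠ k} ↪ β, ∑ _i ∈ (Finset.univ.map f)ᶜ, B := by
        rw [sum_embedding_eq_sum_compl]
        exact Finset.sum_le_sum fun f _ => by simpa using hG f
    _ = ∑ _e : α ↪ β, B := (sum_embedding_eq_sum_compl k fun _ _ => B).symm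
    _ = Fintype.card (α ↪ β) * B := by rw [Finset.sum_const, Finset.card_univ, nsmul_eq_mul]

end Embedding

section Averaging

variable {N K : ℕ} (lo hi : Set.Ioc (0 : ℝ) 1)

/-- The planted instance in which each position `k` has its own attractive product `e k`. -/
noncomputable def plantedEmbedding (e : Fin K ↪ Fin N) : Instance N K :=
  planted lo hi {p | e p.2 = p.1}

/-- An upper bound for the average, over the attractive product of a fixed position, of the expected
fraction of rounds in which that product is displayed there; `N - K + 1` is the number of candidates
left by the other positions. -/
noncomputable def detectionRate (lo hi : ℝ) (N K T : ℕ) : ℝ :=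
  1 / ((N : ℝ) - K + 1) + √((hi - lo) ^ 2 / hi * T / ((N : ℝ) - K + 1))

theorem sum_expDisplayCount_plantedEmbedding_le (hKN : K ≤ N) (π : Policy N K) (T : ℕ)
    (k : Fin K) :
    ∑ e : Fin K ↪ Fin N, expDisplayCount π (plantedEmbedding lo hi e) T (e k) k ≤
      Fintype.card (Fin K ↪ Fin N) * (T * detectionRate lo hi N K T) := by
  let others (f : {l // l ≠ k} ↪ Fin N) : Set (Fin N × Fin K) :=
    {p | ∃ h : p.2 ≠ k, f ⟨p.2, h⟩ = p.1}
  have insert_others (e : Fin K ↪ Fin N) :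
      {p : Fin N × Fin K | e p.2 = p.1} =
        insert (e k, k) (others ((Function.Embedding.subtype _).trans e)) := by
    ext ⟨i, l⟩
    rcases eq_or_ne l k with rfl | hl
    · simp [others, eq_comm]
    · simp [others, hl]
  have card_compl (f : {l // l ≠ k} ↪ Fin N) :
      ((Finset.univ.map f)ᶜ.card : ℝ) = (N : ℝ) - K + 1 := by
    have : 0 < K := k.pos
    have hcard : (Finset.univ.map f)ᶜ.card + K = N + 1 := by
      rw [Finset.card_compl, Finset.card_map, Finset.card_univ, Fintype.card_fin,
        Fintype.card_subtype_compl, Fintype.card_fin, Fintype.card_subtype_eq]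
      omega
    have : ((Finset.univ.map f)ᶜ.card : ℝ) + K = N + 1 := mod_cast hcard
    linarith
  simp only [plantedEmbedding, insert_others]
  refine sum_embedding_le_card_mul k (fun f i =>
    expDisplayCount π (planted lo hi (insert (i, k) (others f))) T i k) fun f => ?_
  have hM : (0 : ℝ) < (Finset.univ.map f)ᶜ.card := by
    have : (K : ℝ) ≤ N := mod_cast hKN
    rw [card_compl]
    linarith
  have := sum_expDisplayCount_planted_insert_le lo hi (others f) k π T
    (Finset.card_pos.1 (Nat.cast_pos.1 hM))
  rwa [card_compl] at this ⊢

theorem exists_sum_expDisplayCount_plantedEmbedding_le (hKN : K ≤ N) (π : Policy N K) (T : ℕ) :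
    ∃ e : Fin K ↪ Fin N, ∑ k, expDisplayCount π (plantedEmbedding lo hi e) T (e k) k ≤
      K * (T * detectionRate lo hi N K T) := by
  have : Nonempty (Fin K ↪ Fin N) := ⟨Fin.castLEEmb hKN⟩
  obtain ⟨e, -, he⟩ := Finset.exists_le_of_sum_le (s := Finset.univ)
    (f := fun e : Fin K ↪ Fin N => ∑ k, expDisplayCount π (plantedEmbedding lo hi e) T (e k) k)
    (g := fun _ => K * (T * detectionRate lo hi N K T)) Finset.univ_nonempty (by
      rw [Finset.sum_comm, Finset.sum_const, Finset.card_univ, nsmul_eq_mul]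
      refine (Finset.sum_le_sum fun k _ =>
        sum_expDisplayCount_plantedEmbedding_le lo hi hKN π T k).trans_eq ?_
      rw [Finset.sum_const, Finset.card_univ, Fintype.card_fin, nsmul_eq_mul]
      ring)
  exact ⟨e, he⟩

end Averaging

section Regret

variable {N K : ℕ} {lo hi : Set.Ioc (0 : ℝ) 1} (e : Fin K ↪ Fin N)

theorem plantedEmbedding_v_apply_self (k : Fin K) :
    (plantedEmbedding lo hi e).v (e k) k = hi := planted_v_of_mem lo hi rfl

theorem plantedEmbedding_v_eq_add_sum (i : Fin N) (k : Fin K) :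
    (plantedEmbedding lo hi e).v i k =
      lo + ∑ l, if (i, k) = (e l, l) then (hi : ℝ) - lo else 0 := by
  by_cases h : e k = i
  · subst h
    rw [plantedEmbedding_v_apply_self, Fintype.sum_eq_single k, if_pos rfl, add_sub_cancel]
    exact fun l hl => if_neg fun h => hl (Prod.ext_iff.1 h).2.symm
  · rw [plantedEmbedding, planted_v_of_notMem lo hi h, Finset.sum_eq_zero, add_zero]
    rintro l -
    refine if_neg fun hl => h ?_
    rw [(Prod.mk.inj hl).1, (Prod.mk.inj hl).2]

theorem denom_plantedEmbedding_le (d : Decision N K) :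
    (plantedEmbedding lo hi e).denom d ≤
      1 + K * (lo : ℝ) + (hi - lo) * ∑ k, if d.Displays (e k) k then 1 else 0 := by
  have card_le : (d.1.card : ℝ) ≤ K := mod_cast d.card_le
  simp only [Instance.denom, plantedEmbedding_v_eq_add_sum, Finset.sum_add_distrib]
  rw [Finset.sum_comm]
  simp only [d.sum_ite_displays_eq, Finset.mul_sum, mul_ite, mul_one, mul_zero, Finset.sum_const,
    Finset.card_univ, Fintype.card_coe, nsmul_eq_mul, ← add_assoc]
  gcongr
  exact lo.2.1.le

theorem exists_denom_plantedEmbedding_eq :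
    ∃ d, (plantedEmbedding lo hi e).denom d = 1 + K * (hi : ℝ) := by
  let σ : Fin K ≃ Finset.univ.map e :=
    e.toEquivRange.trans (Equiv.subtypeEquivRight fun i => by simp)
  refine ⟨⟨Finset.univ.map e, σ.symm.toEmbedding⟩, ?_⟩
  have hσ (k : Fin K) : (plantedEmbedding lo hi e).v (σ k) (σ.symm (σ k)) = hi := by
    rw [σ.symm_apply_apply]
    exact plantedEmbedding_v_apply_self e k
  rw [Instance.denom, ← σ.sum_comp]
  simp only [Equiv.coe_toEmbedding, hσ, Finset.sum_const, Finset.card_univ, Fintype.card_fin,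
    nsmul_eq_mul]

theorem mul_sub_le_optRevenue_sub_revenue_plantedEmbedding (hlo : (lo : ℝ) ≤ hi)
    (d : Decision N K) :
    ((hi : ℝ) - lo) / (1 + K * hi) ^ 2 * (K - ∑ k, if d.Displays (e k) k then 1 else 0) ≤
      (plantedEmbedding lo hi e).optRevenue - (plantedEmbedding lo hi e).revenue d := by
  set I := plantedEmbedding lo hi e
  have hr (i : Fin N) : I.r i = 1 := rfl
  set m : ℝ := ∑ k, if d.Displays (e k) k then 1 else 0
  obtain ⟨dOpt, hOpt⟩ := exists_denom_plantedEmbedding_eq (lo := lo) (hi := hi) e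
  have optRevenue_ge : 1 - 1 / (1 + K * (hi : ℝ)) ≤ I.optRevenue := by
    rw [← hOpt, ← I.revenue_eq_one_sub hr]
    exact I.revenue_le_optRevenue dOpt
  have hD := I.denom_pos d
  have hE : 0 < 1 + K * (hi : ℝ) := hOpt ▸ I.denom_pos dOpt
  have gap_denom : ((hi : ℝ) - lo) * (K - m) ≤ 1 + K * hi - I.denom d := by
    linarith [denom_plantedEmbedding_le (lo := lo) (hi := hi) e d]
  have hm : m ≤ K := (Finset.sum_le_sum fun k _ => ite_le_one le_rfl zero_le_one).trans_eq (by simp)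
  have gap_nonneg : 0 ≤ ((hi : ℝ) - lo) * (K - m) :=
    mul_nonneg (sub_nonneg.2 hlo) (sub_nonneg.2 hm)
  calc ((hi : ℝ) - lo) / (1 + K * hi) ^ 2 * (K - m)
      = ((hi : ℝ) - lo) * (K - m) / ((1 + K * hi) * (1 + K * hi)) := by ring
    _ ≤ (1 + K * hi - I.denom d) / (I.denom d * (1 + K * hi)) := by
        gcongr <;> linarith
    _ = 1 / I.denom d - 1 / (1 + K * hi) := by field_simp
    _ ≤ I.optRevenue - I.revenue d := by
        rw [I.revenue_eq_one_sub hr]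
        linarith

theorem mul_sub_le_regret_plantedEmbedding (hlo : (lo : ℝ) ≤ hi) (π : Policy N K) (T : ℕ) :
    ((hi : ℝ) - lo) / (1 + K * hi) ^ 2 *
        (K * T - ∑ k, expDisplayCount π (plantedEmbedding lo hi e) T (e k) k) ≤
      regret π (plantedEmbedding lo hi e) T := by
  rw [regret_eq_expectation, ← expectation_const (historyLaw π (plantedEmbedding lo hi e) T)
    (K * T : ℝ)]
  unfold expDisplayCount
  rw [← expectation_sum, ← expectation_sub, ← expectation_const_mul]
  refine expectation_mono _ fun h => ?_
  have sum_rounds : (K * T : ℝ) - ∑ k, ∑ t, (if (h t).1.Displays (e k) k then 1 else 0 : ℝ) =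
      ∑ t, ((K : ℝ) - ∑ k, if (h t).1.Displays (e k) k then 1 else 0) := by
    rw [Finset.sum_comm, Finset.sum_sub_distrib, Finset.sum_const, Finset.card_univ,
      Fintype.card_fin, nsmul_eq_mul, mul_comm]
  rw [sum_rounds, Finset.mul_sum]
  exact Finset.sum_le_sum fun t _ =>
    mul_sub_le_optRevenue_sub_revenue_plantedEmbedding e hlo (h t).1

theorem exists_le_regret_plantedEmbedding (hKN : K ≤ N) (hlo : (lo : ℝ) ≤ hi) (π : Policy N K)
    (T : ℕ) :
    ∃ e : Fin K ↪ Fin N,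
      ((hi : ℝ) - lo) / (1 + K * hi) ^ 2 * (K * T * (1 - detectionRate lo hi N K T)) ≤
        regret π (plantedEmbedding lo hi e) T := by
  obtain ⟨e, he⟩ := exists_sum_expDisplayCount_plantedEmbedding_le lo hi hKN π T
  refine ⟨e, le_trans ?_ (mul_sub_le_regret_plantedEmbedding e hlo π T)⟩
  refine mul_le_mul_of_nonneg_left ?_ (div_nonneg (sub_nonneg.2 hlo) (sq_nonneg _))
  linarith

end Regret

section Tuning

variable {N K T : ℕ}

theorem detectionRate_le_two_thirds {lo hi : ℝ} (hKN : (K : ℝ) ≤ N / 4)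
    (hK : 0 < K) (h : (hi - lo) ^ 2 / hi * T ≤ N / 972) : detectionRate lo hi N K T ≤ 2 / 3 := by
  have hK' : (1 : ℝ) ≤ K := mod_cast hK
  have hM : (3 / 4 * N : ℝ) ≤ N - K + 1 := by linarith
  have inv_le : 1 / ((N : ℝ) - K + 1) ≤ 1 / 3 :=
    one_div_le_one_div_of_le three_pos (by linarith)
  have sqrt_le : √((hi - lo) ^ 2 / hi * T / ((N : ℝ) - K + 1)) ≤ 1 / 3 := by
    refine Real.sqrt_le_iff.2 ⟨by norm_num, ?_⟩
    rw [div_le_iff₀ (by linarith)]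
    linarith
  rw [detectionRate]
  linarith

/-- The difference between the two attractions of the hard instances. It is tuned so that `T` rounds
are too few to find the attractive products, and it is at most half of the larger attraction
`1 / (4 * K)` as soon as `4 / 243 * (K * N) ≤ T`. -/
noncomputable def attractionGap (N K T : ℕ) : ℝ :=
  √((K : ℝ) * N * T) / (36 * √3 * (K * T))

theorem attractionGap_nonneg : 0 ≤ attractionGap N K T :=
  div_nonneg (Real.sqrt_nonneg _) (by positivity)

theorem attractionGap_sq (hK : 0 < K) (hT : 0 < T) :
    attractionGap N K T ^ 2 = N / (3888 * K * T) := by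
  rw [attractionGap, div_pow, mul_pow, mul_pow, Real.sq_sqrt (by positivity),
    Real.sq_sqrt zero_le_three]
  field_simp
  ring

theorem attractionGap_le (hK : 0 < K) (hT : 0 < T) (hKNT : 4 / 243 * ((K : ℝ) * N) ≤ T) :
    attractionGap N K T ≤ 1 / (8 * K) := by
  refine (abs_le_of_sq_le_sq' ?_ (by positivity)).2
  rw [attractionGap_sq hK hT, div_pow, one_pow, div_le_div_iff₀ (by positivity) (by positivity)]
  have := mul_le_mul_of_nonneg_right hKNT (K.cast_nonneg (α := ℝ))
  linarith

theorem exists_attractions_sub_eq_attractionGap (hK : 0 < K) (hT : 0 < T)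
    (hKNT : 4 / 243 * ((K : ℝ) * N) ≤ T) :
    ∃ lo hi : Set.Ioc (0 : ℝ) 1, (hi : ℝ) = 1 / (4 * K) ∧ (hi : ℝ) - lo = attractionGap N K T := by
  have hK' : (1 : ℝ) ≤ K := mod_cast hK
  have gap_lt : attractionGap N K T < 1 / (4 * K) := by
    refine (attractionGap_le hK hT hKNT).trans_lt ?_
    gcongr
    norm_num
  have hi_le_one : 1 / (4 * K : ℝ) ≤ 1 := by
    rw [div_le_one₀ (by positivity)]
    linarith
  exact ⟨⟨1 / (4 * K) - attractionGap N K T, sub_pos.2 gap_lt,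
      (sub_le_self _ attractionGap_nonneg).trans hi_le_one⟩,
    ⟨1 / (4 * K), by positivity, hi_le_one⟩, rfl, sub_sub_cancel _ _⟩

theorem exists_mul_sqrt_le_regret (hK : 0 < K) (hKN : (K : ℝ) ≤ N / 4)
    (hKNT : 4 / 243 * ((K : ℝ) * N) ≤ T) (π : Policy N K) :
    ∃ I : Instance N K, 4 / (675 * √3) * √((K : ℝ) * N * T) ≤ regret π I T := by
  have hK' : (0 : ℝ) < K := mod_cast hK
  have hT : 0 < T := Nat.cast_pos.1 (lt_of_lt_of_le (by nlinarith) hKNT : (0 : ℝ) < T)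
  have hKN' : K ≤ N := by exact_mod_cast (by linarith : (K : ℝ) ≤ N)
  obtain ⟨lo, hi, hhi, hgap⟩ := exists_attractions_sub_eq_attractionGap hK hT hKNT
  have detection_le : detectionRate lo hi N K T ≤ 2 / 3 := by
    refine detectionRate_le_two_thirds hKN hK (le_of_eq ?_)
    rw [hgap, attractionGap_sq hK hT, hhi]
    field_simp
    ring
  obtain ⟨e, he⟩ :=
    exists_le_regret_plantedEmbedding hKN' (sub_nonneg.1 (hgap ▸ attractionGap_nonneg)) π T
  refine ⟨plantedEmbedding lo hi e, le_trans ?_ he⟩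
  calc 4 / (675 * √3) * √((K : ℝ) * N * T)
      = attractionGap N K T / (1 + K * (1 / (4 * K))) ^ 2 * (K * T * (1 - 2 / 3)) := by
        rw [attractionGap]
        field_simp
        ring
    _ ≤ ((hi : ℝ) - lo) / (1 + K * hi) ^ 2 * (K * T * (1 - detectionRate lo hi N K T)) := by
        rw [hgap, ← hhi]
        gcongr
        exact div_nonneg attractionGap_nonneg (sq_nonneg _)

theorem one_div_thousand_le_four_div : 1 / 1000 ≤ 4 / (675 * √3) := by
  have : √3 ≤ 2 := Real.sqrt_le_iff.2 ⟨by norm_num, by norm_num⟩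
  rw [div_le_div_iff₀ (by norm_num) (by positivity)]
  linarith

end Tuning

end PositionMNL

theorem theorem3 :
    ∃ η : ℝ, 1 / 1000 ≤ η ∧ η = 4 / (675 * Real.sqrt 3) ∧
      ∀ N K T : ℕ, (K : ℝ) ≤ (N : ℝ) / 4 → 4 / 243 * ((K : ℝ) * (N : ℝ)) ≤ (T : ℝ) →
        ∀ π : PositionMNL.Policy N K, ∃ I : PositionMNL.Instance N K,
          η * Real.sqrt ((K : ℝ) * (N : ℝ) * (T : ℝ)) ≤ PositionMNL.regret π I T := by
  refine ⟨_, PositionMNL.one_div_thousand_le_four_div, rfl, fun N K T hKN hKNT π => ?_⟩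
  rcases K.eq_zero_or_pos with rfl | hK
  · refine ⟨PositionMNL.planted ⟨1, by norm_num⟩ ⟨1, by norm_num⟩ ∅, ?_⟩
    rw [Nat.cast_zero, zero_mul, zero_mul, Real.sqrt_zero, mul_zero]
    exact PositionMNL.regret_nonneg π _ T
  · exact PositionMNL.exists_mul_sqrt_le_regret hK hKN hKNT π
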